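/- Throughout, $X$ is a standard Borel space, $\mathcal R$ is a Borel equivalence relation on $X$ with countable classes, and graphs have oriented edges: every edge $e$ has an origin $o(e)$, a terminus $t(e)$ and an opposite edge $\bar e\neq e$. A Borel equivalence relation always means one with countable classes, on a standard Borel space. *Actions.* An $\mathcal R$-action on a standard Borel space $F$ with a countable-to-one Borel map $\pi:F\to X$ is a Borel map $((x,y),t)\mapsto (x,y)\cdot t$, defined for $(x,y)\in\mathcal R$ and $\pi(t)=y$, such that $\pi((x,y)\cdot t)=x$, $(z,z)\cdot t=t$ and $(x,y)\cdot((y,z)\cdot t)=(x,z)\cdot t$. Its orbit equivalence relation is denoted $\mathcal R_F$, and saturations in $F$ are taken with respect to $\mathcal R_F$. The stabilizer $\mathrm{Stab}(s)$ of a partial section $s:B\to F$ is the relation on $B$ given by $x\sim y\iff s(x)\mathrel{\mathcal R_F}s(y)$. An $\mathcal R$-arboretum $\mathcal A$ is a graph whose vertex space $\mathcal A^0$ and edge space $\mathcal A^1$ carry $\mathcal R$-actions, whose maps $o,t,\bar{\ }$ are Borel, fibre-preserving and equivariant, and whose fibre over each $x\in X$ is a tree. *Graphs of relations.* An oriented graph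 of relations consists of a countable oriented graph $G$, a Borel equivalence relation on a standard Borel space for each vertex and each edge (the same one for $a$ and $\bar a$), and, for each edge $a$, an injective Borel morphism $\iota_a$ from the relation carried by $a$ into the one carried by $t(a)$. Each edge $a$ then carries a partial isomorphism $\iota_{\bar a}(w)\mapsto\iota_a(w)$ from a subset of the space of $o(a)$ onto a subset of the space of $t(a)$. *Desingularizations.* A desingularization of the action of $\mathcal R$ on an $\mathcal R$-arboretum $\mathcal A$ consists of the following data. 1. An oriented graph of relations with underlying graph $G$, and a maximal subtree $A_m$ of $G$ containing all its vertices, with a root vertex. Let $\mathcal S$ be the equivalence relation generated on the disjoint union of the vertex spaces by the partial isomorphisms carried by the edges of $A_m$. The space $Y$ of the root is required to be a fundamental domain of $\mathcal S$, and it is identified with $X$ by a Borel isomorphism. 2. An injective Borel morphism of graphs $\chi$ into $\mathcal A$, from the graph whose vertices (respectively edges) are the points of the spaces carried by the vertices (respectively the edges) of $A_m$. It sends a vertex that is $\mathcal S$-equivalent to $y\in Y$ into the fibre over the point of $X$ identified with $y$. For each vertex and edge of $A_m$, $\chi$ is an isomorphism from the relation it carries onto the restriction of $\mathcal R_{\mathcal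 A^0}$, respectively $\mathcal R_{\mathcal A^1}$, to the image (the *representation*) of its space. The saturations of the representations of the vertex spaces are pairwise disjoint and cover $\mathcal A^0$. 3. For each positively oriented edge $a$ outside $A_m$, a Borel isomorphism $\varphi_a$ between Borel subsets of $X$ with graph contained in $\mathcal R$, and a Borel partial section of edges $s_a$ defined on the source of $\varphi_a$. For $x$ in this source, $o(s_a(x))$ lies in the representation of the space of $o(a)$, and $(\varphi_a(x),x)\cdot t(s_a(x))$ lies in the representation of the space of $t(a)$. Identifying $x$ with $o(s_a(x))$, the relation $\mathrm{Stab}(s_a)$ is the image by $\chi\circ\iota_{\bar a}$ of the relation carried by $a$. Identifying $\varphi_a(x)$ with $(\varphi_a(x),x)\cdot t(s_a(x))$, the relation $\varphi_a\,\mathrm{Stab}(s_a)\,\varphi_a^{-1}$ is the image by $\chi\circ\iota_a$ of the relation carried by $a$. 4. The representation of the space of such an edge $a$ is the image of $s_a$, and that of $\bar a$ is the set of opposite edges. The saturations of the representations of the spaces of all oriented edges of $G$ are pairwise disjoint and cover $\mathcal A^1$. For a vertex $P$ of $G$, let $\mathcal R_P$ be the relation carried by $P$, transported to a subset of $X$ by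 $\chi$ followed by the projection to $X$. For a positive edge $a$ outside $A_m$ put $\varphi_{\bar a}=\varphi_a^{-1}$; for an edge $a$ of $A_m$ let $\varphi_a$ be the identity of the projection to $X$ of the representation of the space of $o(a)$. Let $\mathcal R'$ be the equivalence relation on $X$ generated by all the $\mathcal R_P$, and $\mathcal R''$ the equivalence relation on $X$ generated by all the $\varphi_a$, for $a$ an edge of $G$ (it is trivial outside the domains of the $\varphi_a$). **Proposition 40.** For every desingularization of the action of $\mathcal R$ on an $\mathcal R$-arboretum, $\mathcal R'$ and $\mathcal R''$ are Borel subrelations of $\mathcal R$, and $\mathcal R$ is generated by $\mathcal R'$ and $\mathcal R''$: it is the smallest equivalence relation containing both. Moreover $\mathcal R''$ is treeable, that is, there is an acyclic Borel graph on $X$ whose connected components are the classes of $\mathcal R''$; and for every vertex $P$ of $G$ the intersection of $\mathcal R_P$ with $\mathcal R''$ is trivial: if $x\mathrel{\mathcal R_P}y$ and $x\mathrel{\mathcal R''}y$, then $x=y$. -/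

import Mathlib

/-- An equivalence relation on a measurable space is a *countable Borel equivalence relation* if
it is a measurable subset of the square and all its classes are countable. -/
structure IsCountableBorel {X : Type*} [MeasurableSpace X] (R : Setoid X) : Prop where
  measurableSet : MeasurableSet {p : X × X | R p.1 p.2}
  countable_class : ∀ x, {y | R x y}.Countable

/-! ### Graphs with oriented edges, and trees -/

/-- A graph in the sense of Serre: every (oriented) edge `e` has an origin, a terminus, and an
opposite edge `bar e ≠ e`. -/
structure SerreGraph (V E : Type*) where
  org : E → V
  ter : E → V
  bar : E → E
  bar_bar : ∀ e, bar (bar e) = e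
  bar_ne : ∀ e, bar e ≠ e
  org_bar : ∀ e, org (bar e) = ter e

namespace SerreGraph

/-- The list `l` of edges is a walk from `u` to `v`. -/
def IsWalk {V E : Type*} (G : SerreGraph V E) : V → List E → V → Prop
  | u, [], v => u = v
  | u, e :: l, v => G.org e = u ∧ G.IsWalk (G.ter e) l v

/-- The list `l` has no backtracking: no edge is followed by its opposite. -/
def IsReduced {V E : Type*} (G : SerreGraph V E) (l : List E) : Prop :=
  l.IsChain fun e f => f ≠ G.bar e

/-- The vertex set `S` and the edge set `T` form a subgraph which is a tree: it is nonempty,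
connected, and contains no circuit (closed walk of positive length without backtracking). -/
structure IsTreeOn {V E : Type*} (G : SerreGraph V E) (S : Set V) (T : Set E) : Prop where
  bar_mem : ∀ e ∈ T, G.bar e ∈ T
  org_mem : ∀ e ∈ T, G.org e ∈ S
  nonempty : S.Nonempty
  connected : ∀ u ∈ S, ∀ v ∈ S, ∃ l : List E, (∀ e ∈ l, e ∈ T) ∧ G.IsWalk u l v
  no_circuit : ∀ (u : V) (l : List E), (∀ e ∈ l, e ∈ T) → G.IsWalk u l u → G.IsReduced l → l = []

/-- The graph with an orientation given by the maps `o, t` on its set `E` of positive edges: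
`(a, true)` is the positive edge `a`, and `(a, false)` is its opposite. -/
def ofOriented {V E : Type*} (o t : E → V) : SerreGraph V (E × Bool) where
  org e := if e.2 then o e.1 else t e.1
  ter e := if e.2 then t e.1 else o e.1
  bar e := (e.1, !e.2)
  bar_bar e := by simp
  bar_ne e h := by
    have := congrArg Prod.snd h
    simp at this
  org_bar e := by cases h : e.2 <;> simp

end SerreGraph

/-! ### Actions of an equivalence relation on fibred spaces and on fields of graphs -/

/-- A standard fibred space `proj : F → X` with countable fibres, with a (left) Borel action of `R`.
The element `(x, y) · t` is `act x y t`; it is meaningful only when `R x y` and `t` lies over `y`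
(the values of `act` elsewhere are irrelevant). Empty fibres are allowed, because a tree may have
no edges. -/
structure FibredAction {X : Type*} [MeasurableSpace X] (R : Setoid X)
    (F : Type*) [MeasurableSpace F] where
  proj : F → X
  measurable_proj : Measurable proj
  countable_fibre : ∀ x, {t | proj t = x}.Countable
  act : X → X → F → F
  measurable_act : Measurable
    fun q : {q : (X × X) × F // R q.1.1 q.1.2 ∧ proj q.2 = q.1.2} => act q.1.1.1 q.1.1.2 q.1.2
  proj_act : ∀ x y t, R x y → proj t = y → proj (act x y t) = x
  act_self : ∀ z t, proj t = z → act z z t = t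
  act_act : ∀ x y z t, R x y → R y z → proj t = z → act x y (act y z t) = act x z t

namespace FibredAction

/-- The equivalence relation `R_F` on `F` whose classes are the orbits of the action. -/
def orbitRel {X : Type*} [MeasurableSpace X] {R : Setoid X} {F : Type*} [MeasurableSpace F]
    (A : FibredAction R F) : Setoid F where
  r f g := R (A.proj f) (A.proj g) ∧ A.act (A.proj f) (A.proj g) g = f
  iseqv :=
    { refl := fun f => ⟨R.refl _, A.act_self _ _ rfl⟩
      symm := by
        rintro f g ⟨h, e⟩
        refine ⟨R.symm h, ?_⟩
        conv_lhs => rw [← e]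
        rw [A.proj_act _ _ _ h rfl, A.act_act _ _ _ _ (R.symm h) h rfl, A.act_self _ _ rfl]
      trans := by
        rintro f g k ⟨h, e⟩ ⟨h', e'⟩
        refine ⟨R.trans h h', ?_⟩
        rw [← A.act_act _ _ _ _ h h' rfl, e', e] }

/-- The saturation of a subset of `F` under the action. -/
def saturation {X : Type*} [MeasurableSpace X] {R : Setoid X} {F : Type*} [MeasurableSpace F]
    (A : FibredAction R F) (B : Set F) : Set F :=
  {f | ∃ g ∈ B, A.orbitRel f g}

/-- The stabilizer of a partial section `s : B → F`, an equivalence relation on `B`. -/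
def stab {X : Type*} [MeasurableSpace X] {R : Setoid X} {F : Type*} [MeasurableSpace F]
    (A : FibredAction R F) {B : Set X} (s : B → F) : Setoid B :=
  Setoid.comap s A.orbitRel

end FibredAction

/-- A Borel field of graphs on `X` with an action of `R`: the spaces `V` of vertices and `E` of
edges are fibred over `X` and carry actions of `R`, and the structure maps are Borel and
equivariant and preserve the fibres. -/
structure GraphField {X : Type*} [MeasurableSpace X] (R : Setoid X)
    (V E : Type*) [MeasurableSpace V] [MeasurableSpace E] extends SerreGraph V E where
  vert : FibredAction R V
  edge : FibredAction R E
  measurable_org : Measurable org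
  measurable_ter : Measurable ter
  measurable_bar : Measurable bar
  proj_org : ∀ e, vert.proj (org e) = edge.proj e
  proj_ter : ∀ e, vert.proj (ter e) = edge.proj e
  proj_bar : ∀ e, edge.proj (bar e) = edge.proj e
  org_act : ∀ x y e, R x y → edge.proj e = y → org (edge.act x y e) = vert.act x y (org e)
  ter_act : ∀ x y e, R x y → edge.proj e = y → ter (edge.act x y e) = vert.act x y (ter e)
  bar_act : ∀ x y e, R x y → edge.proj e = y → bar (edge.act x y e) = edge.act x y (bar e)

/-- The field of graphs is an arboretum: the fibre over each point is a tree. -/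
def GraphField.IsArboretum {X : Type*} [MeasurableSpace X] {R : Setoid X}
    {V E : Type*} [MeasurableSpace V] [MeasurableSpace E] (A : GraphField R V E) : Prop :=
  ∀ x, A.IsTreeOn {v | A.vert.proj v = x} {e | A.edge.proj e = x}

/-- An element of the full pseudogroup `[[R]]`: a Borel isomorphism between Borel subsets of `X`
whose graph is contained in `R`. -/
structure FullPseudogroup {X : Type*} [MeasurableSpace X] (R : Setoid X)
    extends PartialEquiv X X where
  measurableSet_source : MeasurableSet source
  measurableSet_target : MeasurableSet target
  measurable_toFun : Measurable (source.domRestrict toFun)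
  measurable_invFun : Measurable (target.domRestrict invFun)
  rel : ∀ x ∈ source, R x (toFun x)

/-! ### Graphs of relations -/

/-- An oriented graph of relations. The underlying graph is countable, with an orientation: `Edge`
is the set of positive edges. A vertex `P` carries the countable Borel equivalence relation `vRel P`
on the standard Borel space `VSp P`; a positive edge `a` and its opposite both carry the relation
`eRel a` on `ESp a`. The injective morphism attached to `a` is `injT a` and the one attached to
the opposite of `a`, whose terminus is `org a`, is `injO a`. -/
structure RelGraph where
  Vert : Type*
  Edge : Type*
  countable_vert : Countable Vert
  countable_edge : Countable Edge
  org : Edge → Vert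
  ter : Edge → Vert
  VSp : Vert → Type*
  ESp : Edge → Type*
  instMV : ∀ P, MeasurableSpace (VSp P)
  instME : ∀ a, MeasurableSpace (ESp a)
  standardV : ∀ P, StandardBorelSpace (VSp P)
  standardE : ∀ a, StandardBorelSpace (ESp a)
  vRel : ∀ P, Setoid (VSp P)
  eRel : ∀ a, Setoid (ESp a)
  vRel_borel : ∀ P, IsCountableBorel (vRel P)
  eRel_borel : ∀ a, IsCountableBorel (eRel a)
  injO : ∀ a, ESp a → VSp (org a)
  injT : ∀ a, ESp a → VSp (ter a)
  measurable_injO : ∀ a, Measurable (injO a)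
  measurable_injT : ∀ a, Measurable (injT a)
  injective_injO : ∀ a, Function.Injective (injO a)
  injective_injT : ∀ a, Function.Injective (injT a)
  injO_rel : ∀ a w w', eRel a w w' → vRel (org a) (injO a w) (injO a w')
  injT_rel : ∀ a w w', eRel a w w' → vRel (ter a) (injT a w) (injT a w')

attribute [instance] RelGraph.countable_vert RelGraph.countable_edge RelGraph.instMV
  RelGraph.instME RelGraph.standardV RelGraph.standardE

namespace RelGraph

/-- The underlying graph. -/
def graph (G : RelGraph) : SerreGraph G.Vert (G.Edge × Bool) :=
  SerreGraph.ofOriented G.org G.ter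

/-- The disjoint union of the spaces carried by the vertices. -/
abbrev VTotal (G : RelGraph) : Type _ := Σ P : G.Vert, G.VSp P

/-- The disjoint union of the spaces carried by the positive edges in `M`. -/
abbrev ETotal (G : RelGraph) (M : Set G.Edge) : Type _ := Σ a : M, G.ESp a

/-- The graph on `G.VTotal` whose edges are the points of the spaces carried by the edges in `M`
and by their opposites: a point `w` of `G.ESp a` joins `injO a w` to `injT a w`. When `M` spans a
rooted tree this is the total space of the arboretum over the space of the root which is defined by
the partial isomorphisms carried by the edges. -/
def totalGraph (G : RelGraph) (M : Set G.Edge) : SerreGraph G.VTotal (G.ETotal M × Bool) :=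
  SerreGraph.ofOriented (fun w => ⟨G.org w.1, G.injO w.1 w.2⟩) (fun w => ⟨G.ter w.1, G.injT w.1 w.2⟩)

/-- The equivalence relation on the disjoint union of the vertex spaces generated by the partial
isomorphisms `injO a w ↦ injT a w` carried by the edges in `M`. -/
def gluing (G : RelGraph) (M : Set G.Edge) : Setoid G.VTotal :=
  Relation.EqvGen.setoid fun q q' => ∃ w : G.ETotal M,
    q = ⟨G.org w.1, G.injO w.1 w.2⟩ ∧ q' = ⟨G.ter w.1, G.injT w.1 w.2⟩

end RelGraph

/-! ### Arboretums of representatives and desingularizations -/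

/-- An arboretum of representatives of the action of `R` on `A`, given by a rooted maximal subtree of
`G` (that is, one which contains all the vertices) whose root carries a space identified with `X`. -/
structure Representatives {X : Type*} [MeasurableSpace X] {R : Setoid X}
    {V E : Type*} [MeasurableSpace V] [MeasurableSpace E]
    (A : GraphField R V E) (G : RelGraph) where
  /-- The positive edges of the maximal subtree. -/
  tree : Set G.Edge
  isTree : G.graph.IsTreeOn Set.univ {e | e.1 ∈ tree}
  root : G.Vert
  /-- The space carried by the root is a fundamental domain of the gluing relation. -/
  rooted : ∀ q : G.VTotal, ∃! r : G.VSp root, G.gluing tree q ⟨root, r⟩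
  /-- The identification of the space carried by the root with `X`. -/
  base : G.VSp root ≃ᵐ X
  /-- The representation on vertices and on edges: an isomorphism onto a subfield of `A`. -/
  χV : G.VTotal → V
  χE : G.ETotal tree × Bool → E
  measurable_χV : Measurable χV
  measurable_χE : Measurable χE
  injective_χV : Function.Injective χV
  injective_χE : Function.Injective χE
  χ_org : ∀ e, A.org (χE e) = χV ((G.totalGraph tree).org e)
  χ_ter : ∀ e, A.ter (χE e) = χV ((G.totalGraph tree).ter e)
  χ_bar : ∀ e, A.bar (χE e) = χE ((G.totalGraph tree).bar e)
  /-- The representation is fibred over the identification `base`. -/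
  proj_χV : ∀ q r, G.gluing tree q ⟨root, r⟩ → A.vert.proj (χV q) = base r
  /-- The relations carried by the vertices and by the edges of the tree are isomorphic, by the
  representation, to the restrictions of the orbit relations. -/
  vRel_iff : ∀ P (y y' : G.VSp P), G.vRel P y y' ↔ A.vert.orbitRel (χV ⟨P, y⟩) (χV ⟨P, y'⟩)
  eRel_iff : ∀ (a : tree) (w w' : G.ESp a) (b : Bool),
    G.eRel a w w' ↔ A.edge.orbitRel (χE (⟨a, w⟩, b)) (χE (⟨a, w'⟩, b))
  /-- The saturations of the representations of the vertex spaces form a partition. -/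
  vertex_cover : ⋃ P, A.vert.saturation (Set.range fun y : G.VSp P => χV ⟨P, y⟩) = Set.univ
  vertex_disjoint : Pairwise fun P Q =>
    Disjoint (A.vert.saturation (Set.range fun y : G.VSp P => χV ⟨P, y⟩))
      (A.vert.saturation (Set.range fun y : G.VSp Q => χV ⟨Q, y⟩))

/-- For injective maps `f : W → F` and `g : B → F`, the images in `F` of the relation `r` on `W` and
of the relation `s` on `B` are the same relation on the same subset of `F`. -/
def SameImage {W B F : Type*} (f : W → F) (r : Setoid W) (g : B → F) (s : Setoid B) : Prop :=
  Set.range f = Set.range g ∧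
    ∀ w w' x x', f w = g x → f w' = g x' → (r w w' ↔ s x x')

/-- An arboretum of representatives, with a partial isomorphism in `[[R]]` and a Borel partial section
of edges, defined on its source, for each positive edge outside the maximal subtree. -/
structure DesingularizationData {X : Type*} [MeasurableSpace X] {R : Setoid X}
    {V E : Type*} [MeasurableSpace V] [MeasurableSpace E]
    (A : GraphField R V E) (G : RelGraph) extends Representatives A G where
  φ : ∀ a : G.Edge, a ∉ tree → FullPseudogroup R
  sec : ∀ (a : G.Edge) (ha : a ∉ tree), (φ a ha).source → E
  measurable_sec : ∀ a ha, Measurable (sec a ha)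
  proj_sec : ∀ a ha x, A.edge.proj (sec a ha x) = x

namespace DesingularizationData

/-- The inverse of `φ a`, from its target to its source. -/
def inv {X : Type*} [MeasurableSpace X] {R : Setoid X}
    {V E : Type*} [MeasurableSpace V] [MeasurableSpace E]
    {A : GraphField R V E} {G : RelGraph} (D : DesingularizationData A G)
    (a : G.Edge) (ha : a ∉ D.tree) (z : (D.φ a ha).target) : (D.φ a ha).source :=
  ⟨(D.φ a ha).invFun z, (D.φ a ha).map_target' z.2⟩

/-- The terminus of the section attached to `a`, moved by `φ a`: over the point `z = φ a x` of the
target it is the vertex `(z, x) · ter (sec a x)`. -/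
def movedTer {X : Type*} [MeasurableSpace X] {R : Setoid X}
    {V E : Type*} [MeasurableSpace V] [MeasurableSpace E]
    {A : GraphField R V E} {G : RelGraph} (D : DesingularizationData A G)
    (a : G.Edge) (ha : a ∉ D.tree) (z : (D.φ a ha).target) : V :=
  A.vert.act z (D.inv a ha z) (A.ter (D.sec a ha (D.inv a ha z)))

/-- The representation in `E` of the space carried by an oriented edge: for a positive edge `a`
outside the tree it is the image of `sec a`, and for its opposite the set of the opposite edges. -/
def edgeRep {X : Type*} [MeasurableSpace X] {R : Setoid X}
    {V E : Type*} [MeasurableSpace V] [MeasurableSpace E]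
    {A : GraphField R V E} {G : RelGraph} (D : DesingularizationData A G)
    (e : G.Edge × Bool) : Set E :=
  {ε | (∃ (h : e.1 ∈ D.tree) (w : G.ESp e.1), ε = D.χE (⟨⟨e.1, h⟩, w⟩, e.2)) ∨
    ∃ (h : e.1 ∉ D.tree) (x : (D.φ e.1 h).source),
      ε = if e.2 then D.sec e.1 h x else A.bar (D.sec e.1 h x)}

end DesingularizationData

/-- A desingularization of the action of `R` on `A`, with underlying oriented graph of relations
`G`. -/
structure Desingularization {X : Type*} [MeasurableSpace X] {R : Setoid X}
    {V E : Type*} [MeasurableSpace V] [MeasurableSpace E]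
    (A : GraphField R V E) (G : RelGraph) extends DesingularizationData A G where
  /-- The origins of the section attached to `a` lie in the representation of the space of `org a`,
  and the termini, moved by `φ a`, lie in the representation of the space of `ter a`. -/
  org_sec_mem : ∀ a ha x, A.org (sec a ha x) ∈ Set.range fun y : G.VSp (G.org a) => χV ⟨G.org a, y⟩
  ter_sec_mem : ∀ a ha z, toDesingularizationData.movedTer a ha z ∈
    Set.range fun y : G.VSp (G.ter a) => χV ⟨G.ter a, y⟩
  /-- The representation carries the image in `vRel (org a)` of the relation carried by `a` to the
  stabilizer of the section, read on the origins of the section. -/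
  stab_org : ∀ a ha, SameImage (fun w : G.ESp a => χV ⟨G.org a, G.injO a w⟩) (G.eRel a)
    (fun x => A.org (sec a ha x)) (A.edge.stab (sec a ha))
  /-- The representation carries the image in `vRel (ter a)` of the relation carried by `a` to the
  stabilizer of the section conjugated by `φ a`, read on the moved termini of the section. -/
  stab_ter : ∀ a ha, SameImage (fun w : G.ESp a => χV ⟨G.ter a, G.injT a w⟩) (G.eRel a)
    (toDesingularizationData.movedTer a ha)
    (Setoid.comap (toDesingularizationData.inv a ha) (A.edge.stab (sec a ha)))
  /-- The saturations of the representations of the spaces carried by the oriented edges form a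
  partition. -/
  edge_cover : ⋃ e, A.edge.saturation (toDesingularizationData.edgeRep e) = Set.univ
  edge_disjoint : Pairwise fun e e' =>
    Disjoint (A.edge.saturation (toDesingularizationData.edgeRep e))
      (A.edge.saturation (toDesingularizationData.edgeRep e'))

namespace Desingularization

/-- The relation carried by the vertex `P`, identified by the representation with a relation on a
subset of `X`. -/
def vertexRel {X : Type*} [MeasurableSpace X] {R : Setoid X}
    {V E : Type*} [MeasurableSpace V] [MeasurableSpace E]
    {A : GraphField R V E} {G : RelGraph} (D : Desingularization A G)
    (P : G.Vert) (x x' : X) : Prop :=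
  ∃ y y' : G.VSp P, G.vRel P y y' ∧
    A.vert.proj (D.χV ⟨P, y⟩) = x ∧ A.vert.proj (D.χV ⟨P, y'⟩) = x'

/-- The graph of the partial isomorphism of `X` carried by an oriented edge: for an edge of the
tree it is the identity on the projection to `X` of the representation of the space carried by
its origin, for a positive edge `a` outside the tree it is `φ a`, and for its opposite it is the
inverse of `φ a`. -/
def edgeIso {X : Type*} [MeasurableSpace X] {R : Setoid X}
    {V E : Type*} [MeasurableSpace V] [MeasurableSpace E]
    {A : GraphField R V E} {G : RelGraph} (D : Desingularization A G)
    (e : G.Edge × Bool) (x x' : X) : Prop :=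
  (e.1 ∈ D.tree ∧ x = x' ∧ ∃ y : G.VSp (G.graph.org e), A.vert.proj (D.χV ⟨G.graph.org e, y⟩) = x) ∨
    ∃ h : e.1 ∉ D.tree,
      if e.2 then x ∈ (D.φ e.1 h).source ∧ (D.φ e.1 h).toFun x = x'
      else x ∈ (D.φ e.1 h).target ∧ (D.φ e.1 h).invFun x = x'

/-- The relation `R'` on `X` generated by the relations carried by the vertices. -/
def vertexPart {X : Type*} [MeasurableSpace X] {R : Setoid X}
    {V E : Type*} [MeasurableSpace V] [MeasurableSpace E]
    {A : GraphField R V E} {G : RelGraph} (D : Desingularization A G) : Setoid X :=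
  Relation.EqvGen.setoid fun x x' => ∃ P, D.vertexRel P x x'

/-- The relation `R''` on `X` generated by the partial isomorphisms carried by the edges. -/
def edgePart {X : Type*} [MeasurableSpace X] {R : Setoid X}
    {V E : Type*} [MeasurableSpace V] [MeasurableSpace E]
    {A : GraphField R V E} {G : RelGraph} (D : Desingularization A G) : Setoid X :=
  Relation.EqvGen.setoid fun x x' => ∃ e, D.edgeIso e x x'

end Desingularization

/-- An equivalence relation is treeable if it has a treeing: a Borel graph on `X` without
cycles whose connected components are the classes of the relation. -/
def IsTreeable {X : Type*} [MeasurableSpace X] (R : Setoid X) : Prop :=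
  ∃ Γ : SimpleGraph X, MeasurableSet {p : X × X | Γ.Adj p.1 p.2} ∧ Γ.IsAcyclic ∧
    ∀ x y, R x y ↔ Γ.Reachable x y

/-! Sort the edges of the arboretum into two kinds: the translates of edges of the arboretum of
representatives (`treeEdges`) and the translates of the sections `sec a`. Inside one fibre, the
vertices covered by a point `y` are connected by tree edges (`Covers.reachIn`), and a vertex covered
by both `y` and `y'` gives a pair in some `R_P` (`Covers.vertexPart`). Hence, for points of one
`R`-class, being `R'`-related means lying in the same component of the forest of tree edges
(`vertexPart_of_reachIn`, `reachIn_of_vertexPart`). An edge of the second kind passes from a vertex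
covered by `y` to one covered by `φ a y`, or the reverse.

Generation is then connectedness of the fibres: read a walk edge by edge (`sup_of_isWalk`).
Treeability and trivial intersection are the absence of circuits. A nonempty trail in the graph of
the `φ a` lifts to a walk whose non-tree edges never cancel, and in a tree such a walk cannot be
closed up by tree edges. So its endpoints are not `R'`-related (`not_vertexPart_of_isTrail`). A
cycle would contradict reflexivity of `R'`, and a pair of distinct points in `R'` and `R''` would
contradict the same lemma.

`R''` is Borel because it is generated by countably many partial Borel maps. For `R'`, the dichotomy
between walks of tree edges and walks with essential non-tree edges presents both `R'` and its
complement as projections of Borel sets, and Souslin's theorem applies. -/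

open MeasureTheory

/-! ### Projections of Borel sets -/

/-- The set `s` is a projection of a Borel set along a standard Borel space. -/
def IsSuslin {α : Type*} [MeasurableSpace α] (s : Set α) : Prop :=
  ∃ t : Set (α × ℝ), MeasurableSet t ∧ Prod.fst '' t = s

namespace IsSuslin

theorem fst_image {α β : Type*} [MeasurableSpace α] [MeasurableSpace β] [StandardBorelSpace β]
    {t : Set (α × β)} (ht : MeasurableSet t) : IsSuslin (Prod.fst '' t) := by
  obtain ⟨e, he⟩ := exists_measurableEmbedding_real β
  refine ⟨Prod.map id e '' t, (MeasurableEmbedding.id.prodMap he).measurableSet_image.2 ht, ?_⟩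
  rw [Set.image_image]
  rfl

theorem of_measurableSet {α : Type*} [MeasurableSpace α] {s : Set α} (hs : MeasurableSet s) :
    IsSuslin s :=
  ⟨Prod.fst ⁻¹' s, measurable_fst hs, Set.image_preimage_eq _ Prod.fst_surjective⟩

theorem preimage {α β : Type*} [MeasurableSpace α] [MeasurableSpace β] {s : Set β}
    (hs : IsSuslin s) {f : α → β} (hf : Measurable f) : IsSuslin (f ⁻¹' s) := by
  obtain ⟨t, ht, rfl⟩ := hs
  refine ⟨Prod.map f id ⁻¹' t, (hf.prodMap measurable_id) ht, ?_⟩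
  ext a
  simp

theorem iUnion {α ι : Type*} [MeasurableSpace α] [Countable ι] {s : ι → Set α}
    (hs : ∀ i, IsSuslin (s i)) : IsSuslin (⋃ i, s i) := by
  choose t ht h using hs
  refine ⟨⋃ i, t i, .iUnion ht, ?_⟩
  rw [Set.image_iUnion]
  simp only [h]

theorem union {α : Type*} [MeasurableSpace α] {s t : Set α} (hs : IsSuslin s) (ht : IsSuslin t) :
    IsSuslin (s ∪ t) := by
  rw [Set.union_eq_iUnion]
  exact iUnion fun b => by cases b <;> assumption

theorem inter {α : Type*} [MeasurableSpace α] {s t : Set α} (hs : IsSuslin s) (ht : IsSuslin t) :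
    IsSuslin (s ∩ t) := by
  obtain ⟨s, hs, rfl⟩ := hs
  obtain ⟨t, ht, rfl⟩ := ht
  have h : MeasurableSet {p : α × (ℝ × ℝ) | (p.1, p.2.1) ∈ s ∧ (p.1, p.2.2) ∈ t} :=
    ((by fun_prop : Measurable fun p : α × (ℝ × ℝ) => (p.1, p.2.1)) hs).inter
      ((by fun_prop : Measurable fun p : α × (ℝ × ℝ) => (p.1, p.2.2)) ht)
  convert fst_image h using 1
  ext a
  simp

theorem exists_snd {α β : Type*} [MeasurableSpace α] [MeasurableSpace β] [StandardBorelSpace β]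
    {s : Set (α × β)} (hs : IsSuslin s) : IsSuslin {a | ∃ b, (a, b) ∈ s} := by
  obtain ⟨t, ht, rfl⟩ := hs
  have h : MeasurableSet {p : α × (β × ℝ) | ((p.1, p.2.1), p.2.2) ∈ t} :=
    (by fun_prop : Measurable fun p : α × (β × ℝ) => ((p.1, p.2.1), p.2.2)) ht
  convert fst_image h using 1
  ext a
  simp

theorem range {α β : Type*} [MeasurableSpace α] [StandardBorelSpace α] [MeasurableSpace β]
    [StandardBorelSpace β] {f : β → α} (hf : Measurable f) : IsSuslin (Set.range f) :=
  exists_snd (s := {p : α × β | f p.2 = p.1})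
    (of_measurableSet (measurableSet_eq_fun (hf.comp measurable_snd) measurable_fst))

/-- Souslin's theorem: a set is Borel if it and its complement are projections of Borel sets. -/
theorem measurableSet {α : Type*} [MeasurableSpace α] [StandardBorelSpace α] {s : Set α}
    (hs : IsSuslin s) (hs' : IsSuslin sᶜ) : MeasurableSet s := by
  let := upgradeStandardBorel α
  obtain ⟨t, ht, h⟩ := hs
  obtain ⟨t', ht', h'⟩ := hs'
  refine AnalyticSet.measurableSet_of_compl ?_ ?_
  · exact h ▸ ht.analyticSet_image measurable_fst
  · exact h' ▸ ht'.analyticSet_image measurable_fst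

end IsSuslin

/-! ### Chains and generated relations -/

/-- The relation of being joined by a chain of `n` steps of the relation `r`. -/
def stepsRel {α : Type*} (r : α → α → Prop) : ℕ → α → α → Prop
  | 0 => Eq
  | n + 1 => fun x z => ∃ y, r x y ∧ stepsRel r n y z

theorem reflTransGen_iff_exists_stepsRel {α : Type*} {r : α → α → Prop} {x y : α} :
    Relation.ReflTransGen r x y ↔ ∃ n, stepsRel r n x y := by
  constructor
  · intro h
    induction h using Relation.ReflTransGen.head_induction_on with
    | refl => exact ⟨0, rfl⟩
    | head h _ ih =>
      obtain ⟨n, hn⟩ := ih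
      exact ⟨n + 1, _, h, hn⟩
  · rintro ⟨n, hn⟩
    induction n generalizing x with
    | zero => exact (show x = y from hn) ▸ .refl
    | succ n ih =>
      obtain ⟨z, hz, h⟩ := hn
      exact .head hz (ih h)

theorem IsSuslin.reflTransGen {α : Type*} [MeasurableSpace α] [StandardBorelSpace α]
    {r : α → α → Prop} (h : IsSuslin {p : α × α | r p.1 p.2}) :
    IsSuslin {p : α × α | Relation.ReflTransGen r p.1 p.2} := by
  simp only [reflTransGen_iff_exists_stepsRel, Set.ofPred_exists]
  refine IsSuslin.iUnion fun n => ?_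
  induction n with
  | zero => exact .of_measurableSet (measurableSet_eq_fun measurable_fst measurable_snd)
  | succ n ih =>
    exact IsSuslin.exists_snd (s := {p : (α × α) × α | r p.1.1 p.2 ∧ stepsRel r n p.2 p.1.2})
      ((h.preimage (by fun_prop : Measurable fun p : (α × α) × α => (p.1.1, p.2))).inter
        (ih.preimage (by fun_prop : Measurable fun p : (α × α) × α => (p.2, p.1.2))))

/-- The relation generated by countably many partial Borel maps is Borel. -/
theorem measurableSet_reflTransGen {α ι : Type*} [MeasurableSpace α] [StandardBorelSpace α]
    [Countable ι] {d : ι → Set α} {f : ι → α → α} (hd : ∀ i, MeasurableSet (d i))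
    (hf : ∀ i, Measurable (f i)) :
    MeasurableSet {p : α × α |
      Relation.ReflTransGen (fun x y => ∃ i, x ∈ d i ∧ f i x = y) p.1 p.2} := by
  simp only [reflTransGen_iff_exists_stepsRel, Set.ofPred_exists]
  refine MeasurableSet.iUnion fun n => ?_
  induction n with
  | zero => exact measurableSet_eq_fun measurable_fst measurable_snd
  | succ n ih =>
    -- The first step is the value of a function, so the intermediate point is substituted rather
    -- than quantified; no projection occurs and the set stays Borel.
    have : MeasurableSet (⋃ i, {p : α × α | p.1 ∈ d i} ∩ {p : α × α |
        stepsRel (fun x y => ∃ i, x ∈ d i ∧ f i x = y) n (f i p.1) p.2}) :=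
      .iUnion fun i => (measurable_fst (hd i)).inter
        ((((hf i).comp measurable_fst).prodMk measurable_snd) ih)
    convert this using 1
    ext p
    simp [stepsRel]

/-! ### Walks avoiding a set of edges -/

namespace SerreGraph

variable {V E : Type*} (G : SerreGraph V E)

theorem ter_bar (e : E) : G.ter (G.bar e) = G.org e := by
  rw [← G.org_bar, G.bar_bar]

theorem isWalk_append {u v : V} {l l' : List E} :
    G.IsWalk u (l ++ l') v ↔ ∃ w, G.IsWalk u l w ∧ G.IsWalk w l' v := by
  induction l generalizing u with
  | nil => simp [IsWalk]
  | cons e l ih => simp [IsWalk, ih, and_assoc]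

/-- Reachability by walks with edges in `T`. -/
def ReachIn (T : Set E) : V → V → Prop :=
  Relation.ReflTransGen fun u v => ∃ e ∈ T, G.org e = u ∧ G.ter e = v

variable {G} {T : Set E}

theorem ReachIn.symm (hT : ∀ e ∈ T, G.bar e ∈ T) {u v : V} (h : G.ReachIn T u v) :
    G.ReachIn T v u := by
  induction h with
  | refl => exact .refl
  | tail _ h ih =>
    obtain ⟨e, he, rfl, rfl⟩ := h
    exact .head ⟨G.bar e, hT e he, G.org_bar e, G.ter_bar e⟩ ih

/-- Prepend edges one at a time to a reduced walk: an edge that would backtrack is cancelled against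
the head instead. -/
theorem ReachIn.exists_isReduced {u v : V} (h : G.ReachIn T u v) :
    ∃ l : List E, (∀ e ∈ l, e ∈ T) ∧ G.IsWalk u l v ∧ G.IsReduced l := by
  induction h using Relation.ReflTransGen.head_induction_on with
  | refl => exact ⟨[], by simp, rfl, List.isChain_nil⟩
  | head h _ ih =>
    obtain ⟨e, he, rfl, rfl⟩ := h
    obtain ⟨l, hl, hw, hr⟩ := ih
    cases l with
    | nil => exact ⟨[e], by simpa, ⟨rfl, hw⟩, List.isChain_singleton _⟩
    | cons f l =>
      by_cases hf : f = G.bar e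
      · refine ⟨l, fun g hg => hl g (by simp [hg]), ?_, hr.tail⟩
        rw [← G.ter_bar, ← hf]
        exact hw.2
      · refine ⟨e :: f :: l, ?_, ⟨rfl, hw⟩, List.isChain_cons_cons.2 ⟨hf, hr⟩⟩
        simpa [he] using hl

variable (G T) in
/-- The edge `f` outside `T` can follow the edge `e` in a walk which is reduced up to the portions
with edges in `T`. -/
def AltStep (e f : E) : Prop :=
  f ∉ T ∧ G.ReachIn T (G.ter e) (G.org f) ∧ f ≠ G.bar e

theorem AltStep.notMem_of_reflTransGen {e f : E} (he : e ∉ T)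
    (h : Relation.ReflTransGen (G.AltStep T) e f) : f ∉ T := by
  cases h with
  | refl => exact he
  | tail _ h => exact h.1

/-- Fill each gap with a reduced walk in `T`. An edge of `T` never backtracks against one outside
`T`, since `T` is stable under `bar`; when the gap is empty, the last clause of `AltStep` excludes
backtracking. Displaying `f` as the last edge lets the next junction be checked. -/
theorem exists_isReduced_of_altStep (hT : ∀ e ∈ T, G.bar e ∈ T) {e f : E} (he : e ∉ T)
    (h : Relation.ReflTransGen (G.AltStep T) e f) :
    ∃ l : List E, G.IsWalk (G.org e) (l ++ [f]) (G.ter f) ∧ G.IsReduced (l ++ [f]) := by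
  induction h with
  | refl => exact ⟨[], ⟨rfl, rfl⟩, List.isChain_singleton _⟩
  | @tail f g hf hg ih =>
    obtain ⟨l, hw, hr⟩ := ih
    have hfT := AltStep.notMem_of_reflTransGen he hf
    obtain ⟨hgT, hfg, hne⟩ := hg
    obtain ⟨p, hpT, hpw, hpr⟩ := hfg.exists_isReduced
    refine ⟨l ++ [f] ++ p, ?_, ?_⟩
    · exact (isWalk_append G).2 ⟨_, (isWalk_append G).2 ⟨_, hw, hpw⟩, rfl, rfl⟩
    · rw [List.append_assoc]
      refine List.isChain_append.2 ⟨hr, List.isChain_append.2 ⟨hpr, List.isChain_singleton _, ?_⟩, ?_⟩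
      · rintro x hx y hy rfl
        simp only [List.head?_cons, Option.mem_def, Option.some.injEq] at hy
        exact hgT (hy ▸ hT x (hpT x (List.mem_of_getLast? hx)))
      · intro x hx y hy
        obtain rfl : f = x := by simpa using hx
        cases p with
        | nil =>
          obtain rfl : g = y := by simpa using hy
          exact hne
        | cons a p =>
          obtain rfl : a = y := by simpa using hy
          rintro rfl
          exact hfT (by simpa [G.bar_bar] using hT _ (hpT (G.bar f) (by simp)))

/-- In an acyclic graph, a nonempty walk with first and last edge outside `T`, reduced up to the
portions with edges in `T`, cannot be closed by a walk with edges in `T`. -/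
theorem not_reachIn_of_altStep (hG : ∀ u l, G.IsWalk u l u → G.IsReduced l → l = [])
    (hT : ∀ e ∈ T, G.bar e ∈ T) {e f : E} (he : e ∉ T)
    (h : Relation.ReflTransGen (G.AltStep T) e f) : ¬ G.ReachIn T (G.ter f) (G.org e) := by
  intro hr
  obtain ⟨l, hlw, hlr⟩ := exists_isReduced_of_altStep hT he h
  obtain ⟨p, hpT, hpw, hpr⟩ := hr.exists_isReduced
  -- `IsReduced` imposes nothing between the last edge and the first one, so only the junction of
  -- `f` with `p` has to be examined.
  have := hG (G.org e) (l ++ [f] ++ p) ((isWalk_append G).2 ⟨_, hlw, hpw⟩)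
    (List.isChain_append.2 ⟨hlr, hpr, ?_⟩)
  · simp at this
  · intro x hx y hy hxy
    obtain rfl : f = x := by simpa using hx
    refine AltStep.notMem_of_reflTransGen he h ?_
    rw [← G.bar_bar f, ← hxy]
    exact hT y (hpT y (List.mem_of_head? hy))

/-- A walk either can be replaced by one with edges in `T`, or is equivalent to one which is reduced
up to the portions with edges in `T`. -/
theorem reachIn_or_exists_altStep {u v : V} {l : List E}
    (h : G.IsWalk u l v) : G.ReachIn T u v ∨ ∃ e f, e ∉ T ∧ G.ReachIn T u (G.org e) ∧
      Relation.ReflTransGen (G.AltStep T) e f ∧ G.ReachIn T (G.ter f) v := by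
  induction l generalizing u with
  | nil => exact .inl ((show u = v from h) ▸ .refl)
  | cons g l ih =>
    obtain ⟨rfl, h⟩ := h
    by_cases hg : g ∈ T
    · have hs : ∀ {w}, G.ReachIn T (G.ter g) w → G.ReachIn T (G.org g) w :=
        .head ⟨g, hg, rfl, rfl⟩
      exact (ih h).imp hs fun ⟨e, f, he, h1, h2⟩ => ⟨e, f, he, hs h1, h2⟩
    · rcases ih h with h1 | ⟨e, f, he, h1, h2, h3⟩
      · exact .inr ⟨g, g, hg, .refl, .refl, h1⟩
      -- If `g` is undone by the first essential edge `e`, both disappear: either no essential edge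
      -- remains, or the walk now starts with the second one.
      · by_cases heg : e = G.bar g
        · have ho : G.ter e = G.org g := by rw [heg, G.ter_bar]
          rcases h2.cases_head with rfl | ⟨e', h4, h5⟩
          · exact .inl (ho ▸ h3)
          · exact .inr ⟨e', f, h4.1, ho ▸ h4.2.1, h5, h3⟩
        · exact .inr ⟨g, f, hg, .refl, .head ⟨he, h1, heg⟩ h2, h3⟩

end SerreGraph

/-! ### Actions -/

namespace FibredAction

variable {X F : Type*} [MeasurableSpace X] [MeasurableSpace F] {R : Setoid X}
  (A : FibredAction R F)

theorem orbitRel_act {x : X} {f : F} (h : R x (A.proj f)) :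
    A.orbitRel (A.act x (A.proj f) f) f := by
  have := A.proj_act _ _ _ h rfl
  exact ⟨by rwa [this], by rw [this]⟩

-- The point over `x` in the orbit of `g` can only be `A.act x (A.proj g) g`. This uniqueness
-- identifies translated endpoints with prescribed vertices.
variable {A} in
theorem eq_of_orbitRel {f f' g : F} (h : A.orbitRel f g) (h' : A.orbitRel f' g)
    (hp : A.proj f = A.proj f') : f = f' := by
  rw [← h.2, ← h'.2, hp]

theorem measurableSet_orbitRel [StandardBorelSpace X] [StandardBorelSpace F]
    (hR : MeasurableSet {p : X × X | R p.1 p.2}) :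
    MeasurableSet {p : F × F | A.orbitRel p.1 p.2} := by
  have hp := A.measurable_proj
  have hS : MeasurableSet {p : F × F | R (A.proj p.1) (A.proj p.2)} :=
    (by fun_prop : Measurable fun p : F × F => (A.proj p.1, A.proj p.2)) hR
  have hm : Measurable fun p : {p : F × F | R (A.proj p.1) (A.proj p.2)} =>
      A.act (A.proj p.1.1) (A.proj p.1.2) p.1.2 :=
    A.measurable_act.comp (g := fun q : {q : (X × X) × F // R q.1.1 q.1.2 ∧ A.proj q.2 = q.1.2} =>
      A.act q.1.1.1 q.1.1.2 q.1.2)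
      (f := fun p : {p : F × F | R (A.proj p.1) (A.proj p.2)} =>
        ⟨((A.proj p.1.1, A.proj p.1.2), p.1.2), p.2, rfl⟩)
      (Measurable.subtype_mk (by fun_prop))
  convert hS.subtype_image (measurableSet_eq_fun hm (measurable_subtype_coe.fst)) using 1
  ext p
  constructor
  · rintro ⟨h1, h2⟩
    exact ⟨⟨p, h1⟩, h2, rfl⟩
  · rintro ⟨q, h, rfl⟩
    exact ⟨q.2, h⟩

theorem isSuslin_saturation [StandardBorelSpace X] [StandardBorelSpace F]
    (hR : MeasurableSet {p : X × X | R p.1 p.2}) {B : Set F} (hB : IsSuslin B) :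
    IsSuslin (A.saturation B) := by
  exact IsSuslin.exists_snd (s := {p : F × F | p.2 ∈ B ∧ A.orbitRel p.1 p.2})
    ((hB.preimage measurable_snd).inter (.of_measurableSet (A.measurableSet_orbitRel hR)))

end FibredAction

/-! ### Equivariance and walks in fields of graphs -/

namespace GraphField

variable {X V E : Type*} [MeasurableSpace X] [MeasurableSpace V] [MeasurableSpace E]
  {R : Setoid X} {A : GraphField R V E}

theorem orbitRel_org {e f : E} (h : A.edge.orbitRel e f) :
    A.vert.orbitRel (A.org e) (A.org f) := by
  obtain ⟨h1, h2⟩ := h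
  refine ⟨by rwa [A.proj_org, A.proj_org], ?_⟩
  rw [A.proj_org, A.proj_org, ← A.org_act _ _ _ h1 rfl, h2]

theorem orbitRel_ter {e f : E} (h : A.edge.orbitRel e f) :
    A.vert.orbitRel (A.ter e) (A.ter f) := by
  obtain ⟨h1, h2⟩ := h
  refine ⟨by rwa [A.proj_ter, A.proj_ter], ?_⟩
  rw [A.proj_ter, A.proj_ter, ← A.ter_act _ _ _ h1 rfl, h2]

theorem orbitRel_bar {e f : E} (h : A.edge.orbitRel e f) :
    A.edge.orbitRel (A.bar e) (A.bar f) := by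
  obtain ⟨h1, h2⟩ := h
  refine ⟨by rwa [A.proj_bar, A.proj_bar], ?_⟩
  rw [A.proj_bar, A.proj_bar, ← A.bar_act _ _ _ h1 rfl, h2]

theorem proj_eq_of_isWalk {u v : V} {l : List E} (h : A.IsWalk u l v) :
    ∀ e ∈ l, A.edge.proj e = A.vert.proj u := by
  induction l generalizing u with
  | nil => simp
  | cons e l ih =>
    obtain ⟨rfl, h⟩ := h
    intro f hf
    rcases List.mem_cons.1 hf with rfl | hf
    · rw [A.proj_org]
    · rw [ih h f hf, A.proj_ter, A.proj_org]

/-- A walk stays in the fibre of its first vertex, so the fibrewise tree condition excludes circuits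
in the total graph. -/
theorem IsArboretum.eq_nil (hA : A.IsArboretum) (u : V) (l : List E) (h : A.IsWalk u l u)
    (hl : A.IsReduced l) : l = [] :=
  (hA (A.vert.proj u)).no_circuit u l (proj_eq_of_isWalk h) h hl

end GraphField

/-! ### The translates of the arboretum of representatives -/

namespace Desingularization

variable {X V E : Type*} [MeasurableSpace X] [MeasurableSpace V] [MeasurableSpace E]
  {R : Setoid X} {A : GraphField R V E} {G : RelGraph} (D : Desingularization A G)

/-- The vertex `u` lies in the translate of the tree of representatives over `y`. -/
def Covers (y : X) (u : V) : Prop :=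
  ∃ q, A.vert.proj (D.χV q) = y ∧ A.vert.orbitRel u (D.χV q)

/-- The edges which are translates of edges of the arboretum of representatives. -/
def treeEdges : Set E :=
  {ε | ∃ e : G.Edge × Bool, e.1 ∈ D.tree ∧ ε ∈ A.edge.saturation (D.edgeRep e)}

/-- The edge `e` is a translate of one which represents an edge outside the maximal subtree, and joins
the translates of the trees of representatives over `y` and over `y'`. -/
def Joins (y y' : X) (e : E) : Prop :=
  ∃ (a : G.Edge) (ha : a ∉ D.tree),
    (∃ h : y ∈ (D.φ a ha).source, (D.φ a ha).toFun y = y' ∧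
      A.edge.orbitRel e (D.sec a ha ⟨y, h⟩)) ∨
    ∃ h : y' ∈ (D.φ a ha).source, (D.φ a ha).toFun y' = y ∧
      A.edge.orbitRel e (A.bar (D.sec a ha ⟨y', h⟩))

/-- The points `x` and `y` are exchanged by a partial isomorphism carried by an edge outside the
maximal subtree. -/
def Adjacent (x y : X) : Prop :=
  ∃ (a : G.Edge) (ha : a ∉ D.tree), (x ∈ (D.φ a ha).source ∧ (D.φ a ha).toFun x = y) ∨
    (y ∈ (D.φ a ha).source ∧ (D.φ a ha).toFun y = x)

variable {D}

theorem proj_eq_of_gluing {q q' : G.VTotal} (h : G.gluing D.tree q q') :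
    A.vert.proj (D.χV q) = A.vert.proj (D.χV q') := by
  obtain ⟨r, hr, -⟩ := D.rooted q
  rw [D.proj_χV q r hr, D.proj_χV q' r (Setoid.trans' _ (Setoid.symm' _ h) hr)]

/-- Equal projections give the same root point because `base` is injective. With
`proj_eq_of_gluing`, the gluing classes are exactly the fibres of the projected representation. -/
theorem gluing_of_proj_eq {q q' : G.VTotal} (h : A.vert.proj (D.χV q) = A.vert.proj (D.χV q')) :
    G.gluing D.tree q q' := by
  obtain ⟨r, hr, -⟩ := D.rooted q
  obtain ⟨r', hr', -⟩ := D.rooted q'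
  rw [D.proj_χV q r hr, D.proj_χV q' r' hr'] at h
  obtain rfl := D.base.injective h
  exact Setoid.trans' _ hr (Setoid.symm' _ hr')

variable (D) in
/-- The representative of the root over `x`. -/
def rootPoint (x : X) : V := D.χV ⟨D.root, D.base.symm x⟩

theorem proj_rootPoint (x : X) : A.vert.proj (D.rootPoint x) = x := by
  rw [rootPoint, D.proj_χV _ _ (Setoid.refl' _ _), MeasurableEquiv.apply_symm_apply]

theorem covers_rootPoint {x : X} {u : V} (h : A.vert.orbitRel u (D.rootPoint x)) :
    D.Covers x u :=
  ⟨_, D.proj_rootPoint x, h⟩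

theorem Covers.rel {y : X} {u : V} (h : D.Covers y u) : R (A.vert.proj u) y := by
  obtain ⟨q, rfl, h⟩ := h
  exact h.1

theorem Covers.of_orbitRel {y : X} {u v : V} (h : D.Covers y u) (hv : A.vert.orbitRel v u) :
    D.Covers y v := by
  obtain ⟨q, hq, h⟩ := h
  exact ⟨q, hq, Setoid.trans' _ hv h⟩

theorem bar_mem_edgeRep {e : G.Edge × Bool} {ε : E} (h : ε ∈ D.edgeRep e) :
    A.bar ε ∈ D.edgeRep (e.1, !e.2) := by
  obtain ⟨a, b⟩ := e
  rcases h with ⟨h, w, rfl⟩ | ⟨h, x, rfl⟩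
  · exact .inl ⟨h, w, D.χ_bar _⟩
  · refine .inr ⟨h, x, ?_⟩
    cases b <;> simp [A.bar_bar]

theorem bar_mem_saturation {e : G.Edge × Bool} {ε : E} (h : ε ∈ A.edge.saturation (D.edgeRep e)) :
    A.bar ε ∈ A.edge.saturation (D.edgeRep (e.1, !e.2)) := by
  obtain ⟨g, hg, h⟩ := h
  exact ⟨_, bar_mem_edgeRep hg, GraphField.orbitRel_bar h⟩

theorem eq_of_mem_saturation {e e' : G.Edge × Bool} {ε : E}
    (h : ε ∈ A.edge.saturation (D.edgeRep e)) (h' : ε ∈ A.edge.saturation (D.edgeRep e')) :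
    e = e' := by
  by_contra hne
  exact Set.disjoint_left.1 (D.edge_disjoint hne) h h'

theorem exists_mem_saturation (D : Desingularization A G) (ε : E) :
    ∃ e, ε ∈ A.edge.saturation (D.edgeRep e) := by
  simpa using D.edge_cover.ge (Set.mem_univ ε)

theorem bar_mem_treeEdges (e : E) (h : e ∈ D.treeEdges) : A.bar e ∈ D.treeEdges := by
  obtain ⟨⟨a, b⟩, ha, h⟩ := h
  exact ⟨(a, !b), ha, bar_mem_saturation h⟩

/-- The saturations partition the edges, so the complement is again a countable union of
saturations. This puts it on the same footing as `treeEdges` for measurability. -/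
theorem mem_compl_treeEdges {ε : E} : ε ∈ D.treeEdgesᶜ ↔
    ∃ e : G.Edge × Bool, e.1 ∉ D.tree ∧ ε ∈ A.edge.saturation (D.edgeRep e) := by
  constructor
  · intro h
    obtain ⟨e, he⟩ := D.exists_mem_saturation ε
    exact ⟨e, fun ht => h ⟨e, ht, he⟩, he⟩
  · rintro ⟨e, he, h⟩ ⟨e', he', h'⟩
    exact he (eq_of_mem_saturation h h' ▸ he')

theorem Joins.notMem_treeEdges {y y' : X} {e : E} (h : D.Joins y y' e) : e ∉ D.treeEdges := by
  obtain ⟨a, ha, ⟨h, -, h'⟩ | ⟨h, -, h'⟩⟩ := h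
  · exact mem_compl_treeEdges.2 ⟨(a, true), ha, _, .inr ⟨ha, _, rfl⟩, h'⟩
  · exact mem_compl_treeEdges.2 ⟨(a, false), ha, _, .inr ⟨ha, _, rfl⟩, h'⟩

theorem exists_joins {e : E} (h : e ∉ D.treeEdges) : ∃ y y', D.Joins y y' e := by
  obtain ⟨⟨a, b⟩, ha, g, hg, h⟩ := mem_compl_treeEdges.1 h
  obtain ⟨ht, -⟩ | ⟨_, x, hx⟩ := hg
  · exact absurd ht ha
  · cases b
    · obtain rfl : g = A.bar (D.sec a ha x) := hx
      exact ⟨_, x, a, ha, .inr ⟨x.2, rfl, h⟩⟩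
    · obtain rfl : g = D.sec a ha x := hx
      exact ⟨x, _, a, ha, .inl ⟨x.2, rfl, h⟩⟩

theorem Joins.adjacent {y y' : X} {e : E} (h : D.Joins y y' e) : D.Adjacent y y' := by
  obtain ⟨a, ha, ⟨h, h', -⟩ | ⟨h, h', -⟩⟩ := h
  · exact ⟨a, ha, .inl ⟨h, h'⟩⟩
  · exact ⟨a, ha, .inr ⟨h, h'⟩⟩

theorem Adjacent.symm {x y : X} (h : D.Adjacent x y) : D.Adjacent y x := by
  obtain ⟨a, ha, h⟩ := h
  exact ⟨a, ha, h.symm⟩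

theorem Adjacent.rel {x y : X} (h : D.Adjacent x y) : R x y := by
  obtain ⟨a, ha, ⟨h, rfl⟩ | ⟨h, rfl⟩⟩ := h
  · exact (D.φ a ha).rel _ h
  · exact Setoid.symm' _ ((D.φ a ha).rel _ h)

theorem Adjacent.exists_joins {y y' z : X} (h : D.Adjacent y y') (hz : R z y) :
    ∃ e, A.edge.proj e = z ∧ D.Joins y y' e := by
  have key : ∀ ε : E, R z (A.edge.proj ε) →
      ∃ e, A.edge.proj e = z ∧ A.edge.orbitRel e ε := fun ε hε =>
    ⟨_, A.edge.proj_act _ _ _ hε rfl, A.edge.orbitRel_act hε⟩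
  have hr := h.rel
  obtain ⟨a, ha, ⟨h, h'⟩ | ⟨h, h'⟩⟩ := h
  · obtain ⟨e, he, he'⟩ := key (D.sec a ha ⟨y, h⟩) (by rwa [D.proj_sec])
    exact ⟨e, he, a, ha, .inl ⟨h, h', he'⟩⟩
  · obtain ⟨e, he, he'⟩ := key (A.bar (D.sec a ha ⟨y', h⟩))
      (by rw [A.proj_bar, D.proj_sec]; exact Setoid.trans' _ hz hr)
    exact ⟨e, he, a, ha, .inr ⟨h, h', he'⟩⟩

/-- The saturation containing an edge fixes `a` and the direction, and `bar` reverses the direction.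
Hence the two passages use the same `φ a` in opposite senses, and injectivity (or single-valuedness)
leads back to `y`. Sharing `y'` matters: when stabilizers are nontrivial, one edge joins several
pairs. -/
theorem Joins.eq_of_bar {y y' y'' : X} {e : E} (h : D.Joins y y' e)
    (h' : D.Joins y' y'' (A.bar e)) : y'' = y := by
  obtain ⟨a, ha, ⟨h1, h2, h3⟩ | ⟨h1, h2, h3⟩⟩ := h <;>
    obtain ⟨a', ha', ⟨h1', h2', h3'⟩ | ⟨h1', h2', h3'⟩⟩ := h'
  · have := eq_of_mem_saturation (D := D) (e := (a, false)) (e' := (a', true))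
      (bar_mem_saturation (e := (a, true)) ⟨_, .inr ⟨ha, _, rfl⟩, h3⟩)
      ⟨_, .inr ⟨ha', _, rfl⟩, h3'⟩
    simp at this
  · have := eq_of_mem_saturation (D := D) (e := (a, false)) (e' := (a', false))
      (bar_mem_saturation (e := (a, true)) ⟨_, .inr ⟨ha, _, rfl⟩, h3⟩)
      ⟨_, .inr ⟨ha', _, rfl⟩, h3'⟩
    obtain rfl : a = a' := congrArg Prod.fst this
    exact (D.φ a ha).injOn h1' h1 (h2'.trans h2.symm)
  · have := eq_of_mem_saturation (D := D) (e := (a, true)) (e' := (a', true))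
      (bar_mem_saturation (e := (a, false)) ⟨_, .inr ⟨ha, _, rfl⟩, h3⟩)
      ⟨_, .inr ⟨ha', _, rfl⟩, h3'⟩
    obtain rfl : a = a' := congrArg Prod.fst this
    exact h2'.symm.trans h2
  · have := eq_of_mem_saturation (D := D) (e := (a, true)) (e' := (a', false))
      (bar_mem_saturation (e := (a, false)) ⟨_, .inr ⟨ha, _, rfl⟩, h3⟩)
      ⟨_, .inr ⟨ha', _, rfl⟩, h3'⟩
    simp at this

theorem covers_org_sec {a : G.Edge} (ha : a ∉ D.tree) {x : X} (h : x ∈ (D.φ a ha).source) :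
    D.Covers x (A.org (D.sec a ha ⟨x, h⟩)) := by
  obtain ⟨q, hq⟩ := D.org_sec_mem a ha ⟨x, h⟩
  refine ⟨⟨_, q⟩, ?_, hq ▸ Setoid.refl' _ _⟩
  rw [show D.χV ⟨_, q⟩ = _ from hq, A.proj_org, D.proj_sec]

theorem covers_ter_sec {a : G.Edge} (ha : a ∉ D.tree) {x : X} (h : x ∈ (D.φ a ha).source) :
    D.Covers ((D.φ a ha).toFun x) (A.ter (D.sec a ha ⟨x, h⟩)) := by
  have hinv : D.inv a ha ⟨(D.φ a ha).toFun x, (D.φ a ha).map_source' h⟩ = ⟨x, h⟩ :=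
    Subtype.ext ((D.φ a ha).left_inv' h)
  obtain ⟨q, hq⟩ := D.ter_sec_mem a ha ⟨(D.φ a ha).toFun x, (D.φ a ha).map_source' h⟩
  have hp : A.vert.proj (A.ter (D.sec a ha ⟨x, h⟩)) = x := by rw [A.proj_ter, D.proj_sec]
  have hr : R ((D.φ a ha).toFun x) x := Setoid.symm' _ ((D.φ a ha).rel _ h)
  have hq' : D.χV ⟨_, q⟩ = A.vert.act ((D.φ a ha).toFun x) x (A.ter (D.sec a ha ⟨x, h⟩)) := by
    refine hq.trans ?_
    rw [DesingularizationData.movedTer, hinv]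
  refine ⟨⟨_, q⟩, ?_, Setoid.symm' _ ?_⟩
  · rw [hq', A.vert.proj_act _ _ _ hr hp]
  · have := A.vert.orbitRel_act (x := (D.φ a ha).toFun x) (f := A.ter (D.sec a ha ⟨x, h⟩))
      (by rwa [hp])
    rw [hp] at this
    rwa [hq']

theorem Joins.covers {y y' : X} {e : E} (h : D.Joins y y' e) :
    D.Covers y (A.org e) ∧ D.Covers y' (A.ter e) := by
  obtain ⟨a, ha, ⟨h, rfl, h'⟩ | ⟨h, rfl, h'⟩⟩ := h
  · exact ⟨(covers_org_sec ha h).of_orbitRel (GraphField.orbitRel_org h'),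
      (covers_ter_sec ha h).of_orbitRel (GraphField.orbitRel_ter h')⟩
  · have h1 := GraphField.orbitRel_org h'
    have h2 := GraphField.orbitRel_ter h'
    rw [A.org_bar] at h1
    rw [A.ter_bar] at h2
    exact ⟨(covers_ter_sec ha h).of_orbitRel h1, (covers_org_sec ha h).of_orbitRel h2⟩

theorem exists_covers_of_mem_treeEdges {e : E} (h : e ∈ D.treeEdges) :
    ∃ y, D.Covers y (A.org e) ∧ D.Covers y (A.ter e) := by
  obtain ⟨⟨a, b⟩, ha, ε, ⟨ht, w, rfl⟩ | ⟨ht, -⟩, h⟩ := h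
  · have h1 := GraphField.orbitRel_org h
    have h2 := GraphField.orbitRel_ter h
    have h3 := A.proj_org (D.χE (⟨⟨a, ht⟩, w⟩, b))
    have h4 := A.proj_ter (D.χE (⟨⟨a, ht⟩, w⟩, b))
    rw [D.χ_org] at h1 h3
    rw [D.χ_ter] at h2 h4
    exact ⟨_, ⟨_, h3, h1⟩, ⟨_, h4, h2⟩⟩
  · exact absurd ha ht

theorem exists_covers (D : Desingularization A G) (u : V) : ∃ y, D.Covers y u := by
  have := D.vertex_cover.ge (Set.mem_univ u)
  obtain ⟨P, -, ⟨q, rfl⟩, h⟩ := Set.mem_iUnion.1 this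
  exact ⟨_, _, rfl, h⟩

/-- Each elementary gluing is realised by translating an edge of the representation into the given
fibre. Quantifying over all translates `u`, `u'` lets the transitive case insert a translate of the
middle point. -/
theorem reachIn_of_gluing {q q' : G.VTotal} (h : G.gluing D.tree q q') :
    ∀ u u', A.vert.orbitRel u (D.χV q) → A.vert.orbitRel u' (D.χV q') →
      A.vert.proj u = A.vert.proj u' → A.ReachIn D.treeEdges u u' := by
  change Relation.EqvGen _ q q' at h
  induction h with
  | refl q =>
    intro u u' h h' hp
    exact FibredAction.eq_of_orbitRel h h' hp ▸ .refl
  | symm q q' _ ih =>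
    intro u u' h h' hp
    exact (ih u' u h' h hp.symm).symm bar_mem_treeEdges
  | trans q q₁ q' h1 _ ih ih' =>
    intro u u' h h' hp
    have hr : R (A.vert.proj u) (A.vert.proj (D.χV q₁)) :=
      proj_eq_of_gluing (D := D) (show G.gluing D.tree q q₁ from h1) ▸ h.1
    have ho := A.vert.orbitRel_act hr
    have hp' := A.vert.proj_act _ _ _ hr rfl
    exact (ih u _ h ho hp'.symm).trans (ih' _ u' ho h' (hp'.trans hp))
  | rel q q' h =>
    obtain ⟨w, rfl, rfl⟩ := h
    intro u u' h h' hp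
    have h1 : A.org (D.χE (w, true)) = D.χV ⟨G.org w.1, G.injO w.1 w.2⟩ := D.χ_org _
    have h2 : A.ter (D.χE (w, true)) = D.χV ⟨G.ter w.1, G.injT w.1 w.2⟩ := D.χ_ter _
    rw [← h1] at h
    rw [← h2] at h'
    have hr : R (A.vert.proj u) (A.edge.proj (D.χE (w, true))) := A.proj_org _ ▸ h.1
    have ho := A.edge.orbitRel_act hr
    have hp' := A.edge.proj_act _ _ _ hr rfl
    refine .single ⟨_, ⟨(w.1, true), w.1.2, _, .inl ⟨w.1.2, w.2, rfl⟩, ho⟩, ?_, ?_⟩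
    · exact FibredAction.eq_of_orbitRel (GraphField.orbitRel_org ho) h (by rw [A.proj_org, hp'])
    · exact FibredAction.eq_of_orbitRel (GraphField.orbitRel_ter ho) h'
        (by rw [A.proj_ter, hp', hp])

theorem Covers.reachIn {y : X} {u u' : V} (h : D.Covers y u) (h' : D.Covers y u')
    (hp : A.vert.proj u = A.vert.proj u') : A.ReachIn D.treeEdges u u' := by
  obtain ⟨q, hq, h⟩ := h
  obtain ⟨q', hq', h'⟩ := h'
  exact reachIn_of_gluing (gluing_of_proj_eq (hq.trans hq'.symm)) u u' h h' hp

/-- Disjointness of the vertex saturations forces both representatives to come from the same `P`;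
there the orbit relation is the carried relation. -/
theorem Covers.vertexPart {y y' : X} {u : V} (h : D.Covers y u) (h' : D.Covers y' u) :
    D.vertexPart y y' := by
  obtain ⟨⟨P, q⟩, rfl, h⟩ := h
  obtain ⟨⟨P', q'⟩, rfl, h'⟩ := h'
  obtain rfl : P = P' := by
    by_contra hne
    exact Set.disjoint_left.1 (D.vertex_disjoint hne) ⟨_, ⟨q, rfl⟩, h⟩ ⟨_, ⟨q', rfl⟩, h'⟩
  exact .rel _ _ ⟨P, q, q', (D.vRel_iff _ _ _).2 (Setoid.trans' _ (Setoid.symm' _ h) h'), rfl, rfl⟩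

theorem vertexPart_of_reachIn {u u' : V} (h : A.ReachIn D.treeEdges u u') :
    ∀ {y y' : X}, D.Covers y u → D.Covers y' u' → D.vertexPart y y' := by
  induction h using Relation.ReflTransGen.head_induction_on with
  | refl => exact Covers.vertexPart
  | head h _ ih =>
    obtain ⟨e, he, rfl, rfl⟩ := h
    obtain ⟨z, hz, hz'⟩ := exists_covers_of_mem_treeEdges he
    intro y y' hy hy'
    exact Setoid.trans' _ (hy.vertexPart hz) (ih hz' hy')

theorem vertexPart_le : D.vertexPart ≤ R := by
  refine Setoid.eqvGen_le ?_
  rintro x y ⟨P, q, q', h, rfl, rfl⟩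
  exact ((D.vRel_iff _ _ _).1 h).1

/-- For a generating pair in `R_P`, one vertex of the fibre is a translate of both representatives,
hence covered by both points, and two applications of `Covers.reachIn` meet there. Transitivity
passes through a translate of the root point over `z`. -/
theorem reachIn_of_vertexPart {x y : X} (h : D.vertexPart x y) :
    ∀ {u u' : V}, D.Covers x u → D.Covers y u' → A.vert.proj u = A.vert.proj u' →
      A.ReachIn D.treeEdges u u' := by
  change Relation.EqvGen _ x y at h
  induction h with
  | refl => exact Covers.reachIn
  | symm _ _ _ ih =>
    intro u u' h h' hp
    exact (ih h' h hp.symm).symm bar_mem_treeEdges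
  | trans x z y h1 _ ih ih' =>
    intro u u' h h' hp
    have hr : R (A.vert.proj u) (A.vert.proj (D.rootPoint z)) := by
      rw [proj_rootPoint]
      exact Setoid.trans' _ h.rel (D.vertexPart_le (show D.vertexPart x z from h1))
    have hc := covers_rootPoint (D := D) (A.vert.orbitRel_act hr)
    have hp' := A.vert.proj_act _ _ _ hr rfl
    exact (ih h hc hp'.symm).trans (ih' hc h' (hp'.trans hp))
  | rel x y h =>
    obtain ⟨P, q, q', h, rfl, rfl⟩ := h
    intro u u' hu hu' hp
    have ho := (D.vRel_iff _ _ _).1 h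
    have ho' := A.vert.orbitRel_act hu.rel
    have hp' := A.vert.proj_act _ _ _ hu.rel rfl
    exact (hu.reachIn ⟨_, rfl, ho'⟩ hp'.symm).trans
      (Covers.reachIn ⟨_, rfl, Setoid.trans' _ ho' ho⟩ hu' (hp'.trans hp))

/-! ### The partial isomorphisms carried by the edges -/

/-- Edges of the maximal subtree carry identities and add nothing, and `Adjacent` is already
symmetric. -/
theorem edgePart_iff {x y : X} : D.edgePart x y ↔ Relation.ReflTransGen D.Adjacent x y := by
  constructor
  · intro h
    change Relation.EqvGen _ x y at h
    have hs : ∀ {x y}, Relation.ReflTransGen D.Adjacent x y →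
        Relation.ReflTransGen D.Adjacent y x := by
      intro x y h
      induction h with
      | refl => exact .refl
      | tail _ h ih => exact .head h.symm ih
    induction h with
    | refl => exact .refl
    | symm _ _ _ ih => exact hs ih
    | trans _ _ _ _ _ ih ih' => exact ih.trans ih'
    | rel x y h =>
      obtain ⟨⟨a, b⟩, ⟨-, rfl, -⟩ | ⟨ha, h⟩⟩ := h
      · exact .refl
      · cases b
        · obtain ⟨h, rfl⟩ := h
          exact .single ⟨a, ha, .inr ⟨(D.φ a ha).map_target' h, (D.φ a ha).right_inv' h⟩⟩
        · exact .single ⟨a, ha, .inl h⟩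
  · intro h
    induction h with
    | refl => exact Setoid.refl' _ _
    | tail _ h ih =>
      refine Setoid.trans' _ ih ?_
      obtain ⟨a, ha, h | h⟩ := h
      · exact .rel _ _ ⟨(a, true), .inr ⟨ha, h⟩⟩
      · exact .symm _ _ (.rel _ _ ⟨(a, true), .inr ⟨ha, h⟩⟩)

theorem edgePart_le : D.edgePart ≤ R := by
  intro x y h
  replace h := edgePart_iff.1 h
  induction h with
  | refl => exact Setoid.refl' _ _
  | tail _ h ih => exact Setoid.trans' _ ih h.rel

/-- Crossing a tree edge keeps the `R'`-class of the covering points; crossing any other edge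
applies some `φ a` or its inverse, after an `R'`-adjustment of the covering point. -/
theorem sup_of_isWalk {u v : V} {l : List E} (h : A.IsWalk u l v) :
    ∀ {y y' : X}, D.Covers y u → D.Covers y' v → (D.vertexPart ⊔ D.edgePart) y y' := by
  have hv : D.vertexPart ≤ D.vertexPart ⊔ D.edgePart := le_sup_left
  have he : D.edgePart ≤ D.vertexPart ⊔ D.edgePart := le_sup_right
  induction l generalizing u with
  | nil =>
    obtain rfl : u = v := h
    intro y y' hy hy'
    exact hv (hy.vertexPart hy')
  | cons e l ih =>
    obtain ⟨rfl, h⟩ := h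
    intro y y' hy hy'
    by_cases hT : e ∈ D.treeEdges
    · obtain ⟨z, hz, hz'⟩ := exists_covers_of_mem_treeEdges hT
      exact Setoid.trans' _ (hv (hy.vertexPart hz)) (ih h hz' hy')
    · obtain ⟨z, z', hz⟩ := exists_joins hT
      exact Setoid.trans' _ (hv (hy.vertexPart hz.covers.1))
        (Setoid.trans' _ (he (edgePart_iff.2 (.single hz.adjacent))) (ih h hz.covers.2 hy'))

theorem eq_sup (hA : A.IsArboretum) : R = D.vertexPart ⊔ D.edgePart := by
  refine le_antisymm ?_ (sup_le vertexPart_le edgePart_le)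
  intro x y h
  have hr : R x (A.vert.proj (D.rootPoint y)) := by rwa [proj_rootPoint]
  obtain ⟨l, -, hl⟩ := (hA x).connected (D.rootPoint x) (proj_rootPoint x) _
    (A.vert.proj_act _ _ _ hr rfl)
  exact sup_of_isWalk hl (covers_rootPoint (Setoid.refl' _ _))
    (covers_rootPoint (A.vert.orbitRel_act hr))

/-! ### Lifting trails: acyclicity and trivial intersection -/

variable (D) in
/-- The graph on `X` defined by the partial isomorphisms carried by the edges outside the maximal
subtree. -/
def edgeGraph : SimpleGraph X where
  Adj x y := x ≠ y ∧ D.Adjacent x y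
  symm := ⟨fun _ _ h => ⟨h.1.symm, h.2.symm⟩⟩
  loopless := ⟨fun _ h => h.1 rfl⟩

theorem edgePart_iff_reachable {x y : X} : D.edgePart x y ↔ D.edgeGraph.Reachable x y := by
  rw [edgePart_iff, SimpleGraph.reachable_iff_reflTransGen]
  constructor
  · intro h
    induction h with
    | refl => exact .refl
    | @tail y z _ h ih =>
      by_cases hyz : y = z
      · exact hyz ▸ ih
      · exact ih.tail ⟨hyz, h⟩
  · exact Relation.ReflTransGen.mono (fun _ _ h => h.2) _ _

/-- A trail in `edgeGraph` lifts to a walk in the arboretum. -/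
theorem exists_altStep_of_isTrail {x y z : X} (p : D.edgeGraph.Walk x y) (hp : p.IsTrail)
    (hn : ¬ p.Nil) (hz : R z x) :
    ∃ e f x' y', A.edge.proj e = z ∧ A.edge.proj f = z ∧ D.Joins x x' e ∧ s(x, x') ∈ p.edges ∧
      Relation.ReflTransGen (A.AltStep D.treeEdges) e f ∧ D.Joins y' y f := by
  induction p with
  | nil => simp at hn
  | @cons x x₁ y h p ih =>
    obtain ⟨e, hez, he⟩ := h.2.exists_joins hz
    by_cases hp0 : p.Nil
    · obtain rfl := hp0.eq
      exact ⟨e, e, _, _, hez, hez, he, by simp, .refl, he⟩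
    · rw [SimpleGraph.Walk.isTrail_cons] at hp
      obtain ⟨f, g, x₂, y', hfz, hgz, hf, hmem, hfg, hg⟩ :=
        ih hp.1 hp0 (Setoid.trans' _ hz h.2.rel)
      refine ⟨e, g, _, _, hez, hgz, he, by simp, .head ⟨hf.notMem_treeEdges, ?_, ?_⟩ hfg, hg⟩
      · exact he.covers.2.reachIn hf.covers.1 (by rw [A.proj_ter, A.proj_org, hez, hfz])
      -- If the next lifted edge were the opposite of `e`, then `Joins.eq_of_bar` would make the
      -- trail repeat its first edge. The membership in `p.edges` is carried through the induction
      -- for this purpose.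
      · rintro rfl
        obtain rfl := he.eq_of_bar hf
        exact hp.2 (Sym2.eq_swap ▸ hmem)

/-- Otherwise tree edges would join the terminus of the lifted walk, covered by `y`, to its origin,
covered by `x`, contradicting `not_reachIn_of_altStep`. -/
theorem not_vertexPart_of_isTrail (hA : A.IsArboretum) {x y : X} (p : D.edgeGraph.Walk x y)
    (hp : p.IsTrail) (hn : ¬ p.Nil) : ¬ D.vertexPart x y := by
  intro h
  obtain ⟨e, f, x', y', he, hf, hj, -, hs, hj'⟩ :=
    exists_altStep_of_isTrail p hp hn (Setoid.refl' R x)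
  refine SerreGraph.not_reachIn_of_altStep hA.eq_nil bar_mem_treeEdges hj.notMem_treeEdges hs ?_
  exact reachIn_of_vertexPart (Setoid.symm' _ h) hj'.covers.2 hj.covers.1
    (by rw [A.proj_ter, A.proj_org, he, hf])

theorem isAcyclic_edgeGraph (hA : A.IsArboretum) : D.edgeGraph.IsAcyclic := by
  intro x p hp
  exact not_vertexPart_of_isTrail hA p hp.isTrail hp.not_nil (Setoid.refl' _ _)

theorem eq_of_vertexPart_of_edgePart (hA : A.IsArboretum) {x y : X} (h : D.vertexPart x y)
    (h' : D.edgePart x y) : x = y := by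
  obtain ⟨p, hp⟩ := (edgePart_iff_reachable.1 h').exists_isPath
  by_cases hn : p.Nil
  · exact hn.eq
  · exact absurd h (not_vertexPart_of_isTrail hA p hp.isTrail hn)

theorem vertexPart_iff {x y : X} : D.vertexPart x y ↔
    ∃ u, A.ReachIn D.treeEdges (D.rootPoint x) u ∧ A.vert.proj u = x ∧
      A.vert.orbitRel u (D.rootPoint y) := by
  constructor
  · intro h
    have hr : R x (A.vert.proj (D.rootPoint y)) := by
      rw [proj_rootPoint]
      exact vertexPart_le h
    have ho := A.vert.orbitRel_act hr
    have hp := A.vert.proj_act _ _ _ hr rfl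
    exact ⟨_, reachIn_of_vertexPart h (covers_rootPoint (Setoid.refl' _ _)) (covers_rootPoint ho)
      (by rw [hp, proj_rootPoint]), hp, ho⟩
  · rintro ⟨u, h, -, ho⟩
    exact vertexPart_of_reachIn h (covers_rootPoint (Setoid.refl' _ _)) (covers_rootPoint ho)

/-- Within an `R`-class, connectedness supplies a walk between the two root translates; if tree
edges do not suffice, essential edges survive, and acyclicity makes this exclusive. The negation
thus becomes existential, as Souslin's theorem requires. -/
theorem not_vertexPart_iff (hA : A.IsArboretum) {x y : X} : ¬ D.vertexPart x y ↔
    ¬ R x y ∨ ∃ u e f, (A.vert.proj u = x ∧ A.vert.orbitRel u (D.rootPoint y)) ∧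
      e ∈ D.treeEdgesᶜ ∧ A.ReachIn D.treeEdges (D.rootPoint x) (A.org e) ∧
      Relation.ReflTransGen (A.AltStep D.treeEdges) e f ∧ A.ReachIn D.treeEdges (A.ter f) u := by
  constructor
  · intro h
    by_cases hxy : R x y
    · have hr : R x (A.vert.proj (D.rootPoint y)) := by rwa [proj_rootPoint]
      have ho := A.vert.orbitRel_act hr
      have hp := A.vert.proj_act _ _ _ hr rfl
      obtain ⟨l, -, hl⟩ := (hA x).connected (D.rootPoint x) (proj_rootPoint x) _ hp
      rcases SerreGraph.reachIn_or_exists_altStep (T := D.treeEdges) hl with h' | ⟨e, f, h'⟩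
      · exact absurd (vertexPart_iff.2 ⟨_, h', hp, ho⟩) h
      · exact .inr ⟨_, e, f, ⟨hp, ho⟩, h'⟩
    · exact .inl hxy
  · rintro (h | ⟨u, e, f, ⟨hp, ho⟩, he, h1, h2, h3⟩) h'
    · exact h (vertexPart_le h')
    · refine SerreGraph.not_reachIn_of_altStep hA.eq_nil bar_mem_treeEdges he h2 ?_
      have := reachIn_of_vertexPart h' (covers_rootPoint (Setoid.refl' _ _)) (covers_rootPoint ho)
        (by rw [hp, proj_rootPoint])
      exact h3.trans ((this.symm bar_mem_treeEdges).trans h1)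

/-! ### Measurability -/

theorem measurable_rootPoint : Measurable D.rootPoint :=
  -- The σ-algebra of the disjoint union is an infimum of pushforwards, so `iInf_le` expresses
  -- measurability of the inclusion of one summand.
  D.measurable_χV.comp ((Measurable.of_le_map (iInf_le _ D.root)).comp D.base.symm.measurable)

-- Each `φ a` and its inverse are extended by the identity off their domains, giving total Borel
-- maps; the Boolean selects the direction.
variable (D) in
theorem exists_measurable_partial : ∃ (d : {a // a ∉ D.tree} × Bool → Set X)
    (f : {a // a ∉ D.tree} × Bool → X → X),
    (∀ i, MeasurableSet (d i)) ∧ (∀ i, Measurable (f i)) ∧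
      ∀ x y, D.Adjacent x y ↔ ∃ i, x ∈ d i ∧ f i x = y := by
  classical
  have ext : ∀ {s : Set X} {g : X → X}, MeasurableSet s → Measurable (s.domRestrict g) →
      Measurable (s.piecewise g id) := fun hs hg => by
    refine measurable_of_restrict_of_restrict_compl hs ?_ ?_
    · simpa using hg
    · simpa using measurable_subtype_coe
  refine ⟨fun i => bif i.2 then (D.φ i.1 i.1.2).source else (D.φ i.1 i.1.2).target,
    fun i => bif i.2 then (D.φ i.1 i.1.2).source.piecewise (D.φ i.1 i.1.2).toFun id
      else (D.φ i.1 i.1.2).target.piecewise (D.φ i.1 i.1.2).invFun id, ?_, ?_, ?_⟩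
  · rintro ⟨⟨a, ha⟩, _ | _⟩
    · exact (D.φ a ha).measurableSet_target
    · exact (D.φ a ha).measurableSet_source
  · rintro ⟨⟨a, ha⟩, _ | _⟩
    · exact ext (D.φ a ha).measurableSet_target (D.φ a ha).measurable_invFun
    · exact ext (D.φ a ha).measurableSet_source (D.φ a ha).measurable_toFun
  · intro x y
    constructor
    · rintro ⟨a, ha, ⟨h, rfl⟩ | ⟨h, rfl⟩⟩
      · exact ⟨(⟨a, ha⟩, true), h, Set.piecewise_eq_of_mem _ _ _ h⟩
      · have h' := (D.φ a ha).map_source' h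
        exact ⟨(⟨a, ha⟩, false), h',
          (Set.piecewise_eq_of_mem _ _ _ h').trans ((D.φ a ha).left_inv' h)⟩
    · rintro ⟨⟨⟨a, ha⟩, _ | _⟩, h, rfl⟩
      · refine ⟨a, ha, .inr ?_⟩
        simp only [cond_false] at h ⊢
        rw [Set.piecewise_eq_of_mem _ _ _ h]
        exact ⟨(D.φ a ha).map_target' h, (D.φ a ha).right_inv' h⟩
      · exact ⟨a, ha, .inl ⟨h, (Set.piecewise_eq_of_mem _ _ _ h).symm⟩⟩

variable [StandardBorelSpace X]

theorem measurableSet_adjacent : MeasurableSet {p : X × X | D.Adjacent p.1 p.2} := by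
  obtain ⟨d, f, hd, hf, h⟩ := D.exists_measurable_partial
  simp only [h, Set.ofPred_exists]
  exact .iUnion fun i => (measurable_fst (hd i)).inter
    (measurableSet_eq_fun ((hf i).comp measurable_fst) measurable_snd)

theorem isCountableBorel_edgePart (hR : IsCountableBorel R) : IsCountableBorel D.edgePart := by
  refine ⟨?_, fun x => (hR.countable_class x).mono fun y h => edgePart_le h⟩
  obtain ⟨d, f, hd, hf, h⟩ := D.exists_measurable_partial
  have h' : D.Adjacent = fun x y => ∃ i, x ∈ d i ∧ f i x = y := funext₂ fun x y => propext (h x y)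
  simp only [edgePart_iff, h']
  exact measurableSet_reflTransGen hd hf

theorem isTreeable_edgePart (hA : A.IsArboretum) : IsTreeable D.edgePart :=
  ⟨D.edgeGraph, (measurableSet_eq_fun measurable_fst measurable_snd).compl.inter
    measurableSet_adjacent, isAcyclic_edgeGraph hA, fun _ _ => edgePart_iff_reachable⟩

variable [StandardBorelSpace E]

theorem isSuslin_edgeRep (e : G.Edge × Bool) : IsSuslin (D.edgeRep e) := by
  obtain ⟨a, b⟩ := e
  by_cases ha : a ∈ D.tree
  · have hm : Measurable fun w : G.ESp a => D.χE (⟨⟨a, ha⟩, w⟩, b) :=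
      D.measurable_χE.comp
        ((Measurable.of_le_map (iInf_le _ (⟨a, ha⟩ : D.tree))).prodMk measurable_const)
    convert IsSuslin.range hm using 1
    ext ε
    simp [DesingularizationData.edgeRep, ha, eq_comm]
  · have := (D.φ a ha).measurableSet_source.standardBorel
    have hm : Measurable fun x : (D.φ a ha).source =>
        if b then D.sec a ha x else A.bar (D.sec a ha x) := by
      cases b
      · exact A.measurable_bar.comp (D.measurable_sec a ha)
      · exact D.measurable_sec a ha
    convert IsSuslin.range hm using 1
    ext ε
    simp [DesingularizationData.edgeRep, ha, eq_comm]

theorem isSuslin_treeEdges (hR : IsCountableBorel R) : IsSuslin D.treeEdges := by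
  convert IsSuslin.iUnion fun e : {e : G.Edge × Bool // e.1 ∈ D.tree} =>
    A.edge.isSuslin_saturation hR.measurableSet (isSuslin_edgeRep (D := D) e.1) using 1
  ext ε
  simp [treeEdges]

theorem isSuslin_compl_treeEdges (hR : IsCountableBorel R) : IsSuslin D.treeEdgesᶜ := by
  convert IsSuslin.iUnion fun e : {e : G.Edge × Bool // e.1 ∉ D.tree} =>
    A.edge.isSuslin_saturation hR.measurableSet (isSuslin_edgeRep (D := D) e.1) using 1
  ext ε
  rw [mem_compl_treeEdges]
  simp

variable [StandardBorelSpace V]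

theorem isSuslin_reachIn (hR : IsCountableBorel R) :
    IsSuslin {p : V × V | A.ReachIn D.treeEdges p.1 p.2} := by
  have ho := A.measurable_org
  have ht := A.measurable_ter
  refine IsSuslin.reflTransGen ?_
  refine IsSuslin.exists_snd (s := {p : (V × V) × E | p.2 ∈ D.treeEdges ∧ A.org p.2 = p.1.1 ∧
    A.ter p.2 = p.1.2}) (((isSuslin_treeEdges hR).preimage measurable_snd).inter
      (.of_measurableSet (.inter ?_ ?_)))
  · exact measurableSet_eq_fun (by fun_prop) (by fun_prop)
  · exact measurableSet_eq_fun (by fun_prop) (by fun_prop)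

theorem isSuslin_altStep (hR : IsCountableBorel R) :
    IsSuslin {p : E × E | A.AltStep D.treeEdges p.1 p.2} := by
  have ho := A.measurable_org
  have ht := A.measurable_ter
  have hb := A.measurable_bar
  refine ((isSuslin_compl_treeEdges hR).preimage measurable_snd).inter
    (((isSuslin_reachIn (D := D) hR).preimage
      (by fun_prop : Measurable fun p : E × E => (A.ter p.1, A.org p.2))).inter
        (.of_measurableSet (MeasurableSet.compl ?_)))
  exact measurableSet_eq_fun (by fun_prop) (by fun_prop)

theorem isCountableBorel_vertexPart (hR : IsCountableBorel R) (hA : A.IsArboretum) :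
    IsCountableBorel D.vertexPart := by
  refine ⟨?_, fun x => (hR.countable_class x).mono fun y h => vertexPart_le h⟩
  have ho := A.measurable_org
  have ht := A.measurable_ter
  have hp := A.vert.measurable_proj
  have hv := D.measurable_rootPoint
  have hreach := isSuslin_reachIn (D := D) hR
  have horb : MeasurableSet {p : (X × X) × V |
      A.vert.proj p.2 = p.1.1 ∧ A.vert.orbitRel p.2 (D.rootPoint p.1.2)} :=
    (measurableSet_eq_fun (by fun_prop) (by fun_prop)).inter
      ((by fun_prop : Measurable fun p : (X × X) × V => (p.2, D.rootPoint p.1.2))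
        (A.vert.measurableSet_orbitRel hR.measurableSet))
  refine IsSuslin.measurableSet ?_ ?_
  · simp only [vertexPart_iff]
    exact IsSuslin.exists_snd (s := {p : (X × X) × V |
      A.ReachIn D.treeEdges (D.rootPoint p.1.1) p.2 ∧ A.vert.proj p.2 = p.1.1 ∧
        A.vert.orbitRel p.2 (D.rootPoint p.1.2)})
      ((hreach.preimage (by fun_prop :
        Measurable fun p : (X × X) × V => (D.rootPoint p.1.1, p.2))).inter
          (.of_measurableSet horb))
  · have : {p : X × X | D.vertexPart p.1 p.2}ᶜ = {p : X × X | ¬ D.vertexPart p.1 p.2} := rfl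
    rw [this]
    simp only [not_vertexPart_iff hA]
    refine IsSuslin.union (.of_measurableSet hR.measurableSet.compl) ?_
    refine IsSuslin.exists_snd (s := {p : (X × X) × V | ∃ e f,
        (A.vert.proj p.2 = p.1.1 ∧ A.vert.orbitRel p.2 (D.rootPoint p.1.2)) ∧
          e ∈ D.treeEdgesᶜ ∧ A.ReachIn D.treeEdges (D.rootPoint p.1.1) (A.org e) ∧
          Relation.ReflTransGen (A.AltStep D.treeEdges) e f ∧
          A.ReachIn D.treeEdges (A.ter f) p.2}) ?_
    refine IsSuslin.exists_snd (s := {p : ((X × X) × V) × E | ∃ f,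
        (A.vert.proj p.1.2 = p.1.1.1 ∧ A.vert.orbitRel p.1.2 (D.rootPoint p.1.1.2)) ∧
          p.2 ∈ D.treeEdgesᶜ ∧ A.ReachIn D.treeEdges (D.rootPoint p.1.1.1) (A.org p.2) ∧
          Relation.ReflTransGen (A.AltStep D.treeEdges) p.2 f ∧
          A.ReachIn D.treeEdges (A.ter f) p.1.2}) ?_
    refine IsSuslin.exists_snd (s := {p : (((X × X) × V) × E) × E |
        (A.vert.proj p.1.1.2 = p.1.1.1.1 ∧ A.vert.orbitRel p.1.1.2 (D.rootPoint p.1.1.1.2)) ∧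
          p.1.2 ∈ D.treeEdgesᶜ ∧ A.ReachIn D.treeEdges (D.rootPoint p.1.1.1.1) (A.org p.1.2) ∧
          Relation.ReflTransGen (A.AltStep D.treeEdges) p.1.2 p.2 ∧
          A.ReachIn D.treeEdges (A.ter p.2) p.1.1.2}) ?_
    refine ((IsSuslin.of_measurableSet horb).preimage
      (by fun_prop : Measurable fun p : (((X × X) × V) × E) × E => p.1.1)).inter
      (((isSuslin_compl_treeEdges hR).preimage
        (by fun_prop : Measurable fun p : (((X × X) × V) × E) × E => p.1.2)).inter
      ((hreach.preimage (by fun_prop : Measurable fun p : (((X × X) × V) × E) × E =>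
          (D.rootPoint p.1.1.1.1, A.org p.1.2))).inter
      (((isSuslin_altStep hR).reflTransGen.preimage
        (by fun_prop : Measurable fun p : (((X × X) × V) × E) × E => (p.1.2, p.2))).inter
      (hreach.preimage (by fun_prop : Measurable fun p : (((X × X) × V) × E) × E =>
          (A.ter p.2, p.1.1.2))))))

end Desingularization

theorem proposition40 {X V E : Type*}
    [MeasurableSpace X] [StandardBorelSpace X]
    [MeasurableSpace V] [StandardBorelSpace V]
    [MeasurableSpace E] [StandardBorelSpace E]
    (R : Setoid X) (hR : IsCountableBorel R)
    (A : GraphField R V E) (hA : A.IsArboretum)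
    (G : RelGraph) (D : Desingularization A G) :
    IsCountableBorel D.vertexPart ∧ IsCountableBorel D.edgePart ∧
      R = D.vertexPart ⊔ D.edgePart ∧
      IsTreeable D.edgePart ∧
      ∀ P x y, D.vertexRel P x y → D.edgePart x y → x = y :=
  ⟨D.isCountableBorel_vertexPart hR hA, D.isCountableBorel_edgePart hR, D.eq_sup hA,
    D.isTreeable_edgePart hA, fun P _ _ h h' =>
      D.eq_of_vertexPart_of_edgePart hA (.rel _ _ ⟨P, h⟩) h'⟩
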